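/- Let $C$ be a coalgebra over a field $k$, with comultiplication $\Delta$ and counit $\varepsilon$, and let $C^*$ be its dual algebra with the convolution product $(a*b)(c)=\sum a(c_1)b(c_2)$. Regard $C$ as a right $C^*$-module by $c\cdot a=\sum a(c_1)c_2$ and as a left $C^*$-module by $a\cdot c=\sum c_1a(c_2)$. Call $C$ right (respectively left) co-Frobenius if there is an injective morphism $C\to C^*$ of right (respectively left) $C^*$-modules. A left $C$-comodule $M$ with structure map $\rho:M\to C\otimes M$ has finite support if $\rho(M)\subseteq X\otimes M$ for some finite dimensional subspace $X\subseteq C$; a right $C$-comodule $M$ with structure map $\rho:M\to M\otimes C$ has finite support if $\rho(M)\subseteq M\otimes X$ for some such $X$. For a left (respectively right) $C$-comodule $M$, let $\int_{l,C,M}$ (respectively $\int_{r,C,M}$) be the $k$-vector space of morphisms of left (respectively right) $C$-comodules from $C$ to $M$, where $C$ is a comodule over itself through $\Delta$. Suppose that $C$ is both left and right co-Frobenius. Then $$\dim_k\int_{l,C,M}=\dim_k M$$ for every left $C$-comodule $M$ of finite support, and $$\dim_k\int_{r,C,M}=\dim_k M$$ for every right $C$-comodule $M$ of finite support. Here $M$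 may be infinite dimensional, and the equalities are equalities of cardinal numbers. -/

import Mathlib

universe u v w

open scoped TensorProduct

/-- A left comodule `M` over the coalgebra `C`: a coassociative and counital linear map
`ρ : M → C ⊗ M`. -/
class LeftComodule (k C M : Type*) [Field k] [AddCommGroup C] [Module k C] [Coalgebra k C]
    [AddCommGroup M] [Module k M] where
  /-- The structure map `ρ : M → C ⊗ M`. -/
  coact : M →ₗ[k] C ⊗[k] M
  /-- `(Δ ⊗ id) ∘ ρ = (id ⊗ ρ) ∘ ρ`. -/
  coassoc : (TensorProduct.assoc k C C M).toLinearMap ∘ₗ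
      (Coalgebra.comul (R := k) (A := C)).rTensor M ∘ₗ coact = coact.lTensor C ∘ₗ coact
  /-- `(ε ⊗ id) ∘ ρ = id`. -/
  counital : (TensorProduct.lid k M).toLinearMap ∘ₗ
      (Coalgebra.counit (R := k) (A := C)).rTensor M ∘ₗ coact = LinearMap.id

/-- A right comodule `N` over the coalgebra `C`: a coassociative and counital linear map
`ρ : N → N ⊗ C`. -/
class RightComodule (k C N : Type*) [Field k] [AddCommGroup C] [Module k C] [Coalgebra k C]
    [AddCommGroup N] [Module k N] where
  /-- The structure map `ρ : N → N ⊗ C`. -/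
  coact : N →ₗ[k] N ⊗[k] C
  /-- `(ρ ⊗ id) ∘ ρ = (id ⊗ Δ) ∘ ρ`. -/
  coassoc : (TensorProduct.assoc k N C C).toLinearMap ∘ₗ coact.rTensor C ∘ₗ coact =
      (Coalgebra.comul (R := k) (A := C)).lTensor N ∘ₗ coact
  /-- `(id ⊗ ε) ∘ ρ = id`. -/
  counital : (TensorProduct.rid k N).toLinearMap ∘ₗ
      (Coalgebra.counit (R := k) (A := C)).lTensor N ∘ₗ coact = LinearMap.id

/-- `C` as a left comodule over itself, by comultiplication. -/
abbrev LeftComodule.regular (k C : Type*) [Field k] [AddCommGroup C] [Module k C]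
    [Coalgebra k C] : LeftComodule k C C where
  coact := Coalgebra.comul
  coassoc := Coalgebra.coassoc
  counital := by ext c; simp

/-- `C` as a right comodule over itself, by comultiplication. -/
abbrev RightComodule.regular (k C : Type*) [Field k] [AddCommGroup C] [Module k C]
    [Coalgebra k C] : RightComodule k C C where
  coact := Coalgebra.comul
  coassoc := Coalgebra.coassoc
  counital := by ext c; simp

/-- The space of morphisms of left `C`-comodules from `M` to `M'`. -/
def LeftComodule.homs (k C M M' : Type*) [Field k] [AddCommGroup C] [Module k C] [Coalgebra k C]
    [AddCommGroup M] [Module k M] [LeftComodule k C M]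
    [AddCommGroup M'] [Module k M'] [LeftComodule k C M'] : Submodule k (M →ₗ[k] M') where
  carrier := {f | LeftComodule.coact (C := C) ∘ₗ f = f.lTensor C ∘ₗ LeftComodule.coact}
  add_mem' {f g} hf hg := by
    simp only [Set.mem_ofPred_eq] at hf hg ⊢
    rw [LinearMap.comp_add, hf, hg, LinearMap.lTensor_add, LinearMap.add_comp]
  zero_mem' := by simp
  smul_mem' a f hf := by
    simp only [Set.mem_ofPred_eq] at hf ⊢
    rw [LinearMap.comp_smul, hf, LinearMap.lTensor_smul, LinearMap.smul_comp]

/-- The space of morphisms of right `C`-comodules from `N` to `N'`. -/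
def RightComodule.homs (k C N N' : Type*) [Field k] [AddCommGroup C] [Module k C] [Coalgebra k C]
    [AddCommGroup N] [Module k N] [RightComodule k C N]
    [AddCommGroup N'] [Module k N'] [RightComodule k C N'] : Submodule k (N →ₗ[k] N') where
  carrier := {f | RightComodule.coact (C := C) ∘ₗ f = f.rTensor C ∘ₗ RightComodule.coact}
  add_mem' {f g} hf hg := by
    simp only [Set.mem_ofPred_eq] at hf hg ⊢
    rw [LinearMap.comp_add, hf, hg, LinearMap.rTensor_add, LinearMap.add_comp]
  zero_mem' := by simp
  smul_mem' a f hf := by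
    simp only [Set.mem_ofPred_eq] at hf ⊢
    rw [LinearMap.comp_smul, hf, LinearMap.rTensor_smul, LinearMap.smul_comp]

/-- The space of left `M`-integrals on `C`: the morphisms of left `C`-comodules `C → M`. -/
abbrev LeftIntegrals (k C M : Type*) [Field k] [AddCommGroup C] [Module k C] [Coalgebra k C]
    [AddCommGroup M] [Module k M] [LeftComodule k C M] : Submodule k (C →ₗ[k] M) :=
  letI := LeftComodule.regular k C
  LeftComodule.homs k C C M

/-- The space of right `N`-integrals on `C`: the morphisms of right `C`-comodules `C → N`. -/
abbrev RightIntegrals (k C N : Type*) [Field k] [AddCommGroup C] [Module k C] [Coalgebra k C]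
    [AddCommGroup N] [Module k N] [RightComodule k C N] : Submodule k (C →ₗ[k] N) :=
  letI := RightComodule.regular k C
  RightComodule.homs k C C N

/-- A left comodule `M` has finite support if `ρ(M) ⊆ X ⊗ M` for some finite dimensional
subspace `X` of `C`. -/
def LeftComodule.HasFiniteSupport (k C M : Type*) [Field k] [AddCommGroup C] [Module k C]
    [Coalgebra k C] [AddCommGroup M] [Module k M] [LeftComodule k C M] : Prop :=
  ∃ X : Submodule k C, FiniteDimensional k X ∧
    LinearMap.range (LeftComodule.coact (k := k) (C := C) (M := M)) ≤
      LinearMap.range (X.subtype.rTensor M)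

/-- A right comodule `N` has finite support if `ρ(N) ⊆ N ⊗ X` for some finite dimensional
subspace `X` of `C`. -/
def RightComodule.HasFiniteSupport (k C N : Type*) [Field k] [AddCommGroup C] [Module k C]
    [Coalgebra k C] [AddCommGroup N] [Module k N] [RightComodule k C N] : Prop :=
  ∃ X : Submodule k C, FiniteDimensional k X ∧
    LinearMap.range (RightComodule.coact (k := k) (C := C) (N := N)) ≤
      LinearMap.range (X.subtype.lTensor N)

/-- The dual algebra `C*`, with the convolution product
`(a * b)(c) = ∑ a(c₁) b(c₂)` and unit `ε`. -/
abbrev DualAlgebra (k C : Type*) [Field k] [AddCommGroup C] [Module k C] [Coalgebra k C] :=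
  WithConv (C →ₗ[k] k)

/-- The right `C*`-module structure of a left comodule: `m · a = ∑ a(m₋₁) m₀`. -/
def LeftComodule.act {k C M : Type*} [Field k] [AddCommGroup C] [Module k C] [Coalgebra k C]
    [AddCommGroup M] [Module k M] [LeftComodule k C M] (m : M) (a : DualAlgebra k C) : M :=
  TensorProduct.lid k M (a.ofConv.rTensor M (LeftComodule.coact m))

/-- The left `C*`-module structure of a right comodule: `a · n = ∑ n₀ a(n₁)`. -/
def RightComodule.act {k C N : Type*} [Field k] [AddCommGroup C] [Module k C] [Coalgebra k C]
    [AddCommGroup N] [Module k N] [RightComodule k C N] (a : DualAlgebra k C) (n : N) : N :=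
  TensorProduct.rid k N (a.ofConv.lTensor N (RightComodule.coact n))

/-- `C` is right co-Frobenius if `C` embeds in `C*` as a right `C*`-module. -/
def IsRightCoFrobenius (k C : Type*) [Field k] [AddCommGroup C] [Module k C]
    [Coalgebra k C] : Prop :=
  letI := LeftComodule.regular k C
  ∃ f : C →ₗ[k] DualAlgebra k C, Function.Injective f ∧
    ∀ (c : C) (a : DualAlgebra k C), f (LeftComodule.act c a) = f c * a

/-- `C` is left co-Frobenius if `C` embeds in `C*` as a left `C*`-module. -/
def IsLeftCoFrobenius (k C : Type*) [Field k] [AddCommGroup C] [Module k C]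
    [Coalgebra k C] : Prop :=
  letI := RightComodule.regular k C
  ∃ f : C →ₗ[k] DualAlgebra k C, Function.Injective f ∧
    ∀ (a : DualAlgebra k C) (c : C), f (RightComodule.act a c) = a * f c

/-! A left co-Frobenius embedding $f$ gives a balanced form $B(x,y)=f(x)(y)$ that is nondegenerate
in $x$; a right one $g$ gives a balanced form $B'(x,y)=g(y)(x)$ that is nondegenerate in $y$. For a
left comodule $M$, the map $m\mapsto(c\mapsto\sum B(m_{-1},c)\,m_0)$ lands in the integrals because
$B$ is balanced, and is injective because $B$ is. It remains to show that it is onto.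

Let $\rho(M)\subseteq X\otimes M$ with $X$ finite dimensional, and let $X^\perp\subseteq C^*$ be the
functionals vanishing on $X$. If $h$ is an integral and $\varphi\in M^*$, then
$X^\perp*(\varphi\circ h)=0$. The key point (`annConv_eq_map`) is that the part of $C^*$ killed by
$X^\perp$ is exactly the image under $B$ of the part of $C$ killed by $X^\perp$, which lies in $X$.
Hence $h$ comes from a tensor $t\in C\otimes M$ (`exists_pair_eq`); colinearity of $h$ makes $t$
coassociative, and the counit then gives $t=\rho(m)$. The right-hand case follows over the
co-opposite coalgebra. -/

namespace CoFrobenius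

/-! ### Duality for vector spaces -/

section Dual

variable {k C : Type*} [Field k] [AddCommGroup C] [Module k C]

/-- Two vectors with the same values under all functionals are equal. -/
lemma eq_of_forall_dual {x y : C}
    (h : ∀ a : C →ₗ[k] k, a x = a y) : x = y := by
  rw [← sub_eq_zero, ← Module.forall_dual_apply_eq_zero_iff k]
  intro a
  simp [h a]

/-- A left nondegenerate bilinear form induces every functional on a finite dimensional subspace
from the right. -/
lemma exists_flip_eq_on {B : C →ₗ[k] C →ₗ[k] k} (hB : Function.Injective B)
    (X : Submodule k C) [FiniteDimensional k X] (a : C →ₗ[k] k) :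
    ∃ y, ∀ x ∈ X, B x y = a x := by
  -- As `X` is finite dimensional, injectivity of `X → C*` is equivalent to surjectivity of `C →
  -- X*`.
  have hs : Function.Surjective (B ∘ₗ X.subtype).flip := by
    rw [LinearMap.flip_surjective_iff₁]
    exact hB.comp X.injective_subtype
  obtain ⟨y, hy⟩ := hs (a ∘ₗ X.subtype)
  exact ⟨y, fun x hx ↦ LinearMap.congr_fun hy ⟨x, hx⟩⟩

/-- A vector killed by all functionals that vanish on a subspace lies in the subspace. -/
lemma mem_of_forall_dual (X : Submodule k C) (c : C)
    (h : ∀ i : C →ₗ[k] k, (∀ x ∈ X, i x = 0) → i c = 0) : c ∈ X := by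
  by_contra hc
  obtain ⟨i, hi, hX⟩ := X.exists_le_ker_of_notMem hc
  exact hi (h i fun x hx ↦ hX hx)

end Dual

/-! ### Balanced forms and annihilators -/

section Forms

variable {k C : Type*} [Field k] [AddCommGroup C] [Module k C] [Coalgebra k C]

open Coalgebra WithConv

/-- The left action of a functional on a coalgebra: `a · c = ∑ c₁ a(c₂)`. -/
def actL (a : C →ₗ[k] k) : C →ₗ[k] C :=
  (TensorProduct.rid k C).toLinearMap ∘ₗ a.lTensor C ∘ₗ comul

/-- The right action of a functional on a coalgebra: `c · a = ∑ a(c₁) c₂`. -/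
def actR (a : C →ₗ[k] k) : C →ₗ[k] C :=
  (TensorProduct.lid k C).toLinearMap ∘ₗ a.rTensor C ∘ₗ comul

/-- The convolution product of two functionals on a coalgebra. -/
noncomputable def conv (a b : C →ₗ[k] k) : C →ₗ[k] k := (toConv a * toConv b).ofConv

lemma conv_assoc (a b c : C →ₗ[k] k) : conv (conv a b) c = conv a (conv b c) :=
  congrArg ofConv (mul_assoc (toConv a) (toConv b) (toConv c))

lemma counit_conv (a : C →ₗ[k] k) : conv counit a = a :=
  congrArg ofConv (one_mul (toConv a))

lemma conv_counit (a : C →ₗ[k] k) : conv a counit = a :=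
  congrArg ofConv (mul_one (toConv a))

lemma sub_conv (a b c : C →ₗ[k] k) : conv (a - b) c = conv a c - conv b c :=
  congrArg ofConv (sub_mul (toConv a) (toConv b) (toConv c))

lemma conv_sub (a b c : C →ₗ[k] k) : conv a (b - c) = conv a b - conv a c :=
  congrArg ofConv (mul_sub (toConv a) (toConv b) (toConv c))

lemma apply_actR (a b : C →ₗ[k] k) (c : C) : b (actR a c) = conv a b c := by
  change (b ∘ₗ (TensorProduct.lid k C).toLinearMap ∘ₗ a.rTensor C) (comul c) =
    (LinearMap.mul' k k ∘ₗ TensorProduct.map a b) (comul c)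
  congr 1
  ext x y
  simp

lemma apply_actL (a b : C →ₗ[k] k) (c : C) : a (actL b c) = conv a b c := by
  change (a ∘ₗ (TensorProduct.rid k C).toLinearMap ∘ₗ b.lTensor C) (comul c) =
    (LinearMap.mul' k k ∘ₗ TensorProduct.map a b) (comul c)
  congr 1
  ext x y
  simp [mul_comm]

/-- A bilinear form on a coalgebra is balanced if `B(a · x, y) = B(x, y · a)`. -/
def IsBalanced (B : C →ₗ[k] C →ₗ[k] k) : Prop :=
  ∀ (a : C →ₗ[k] k) (x y : C), B (actL a x) y = B x (actR a y)

namespace IsBalanced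

variable {B : C →ₗ[k] C →ₗ[k] k} (hB : IsBalanced B)
include hB

lemma apply_left (a : C →ₗ[k] k) (x : C) : B (actL a x) = conv a (B x) := by
  ext y
  rw [hB, apply_actR]

lemma apply_right (a : C →ₗ[k] k) (y : C) : B.flip (actR a y) = conv (B.flip y) a := by
  ext x
  rw [LinearMap.flip_apply, ← hB, ← LinearMap.flip_apply, apply_actL]

/-- The coalgebra form of balancedness: `∑ B(x₁, y) x₂ = ∑ y₁ B(x, y₂)`. -/
lemma actR_flip (x y : C) : actR (B.flip y) x = actL (B x) y := by
  refine eq_of_forall_dual (k := k) fun a ↦ ?_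
  rw [apply_actR, apply_actL, ← hB.apply_left, ← apply_actL (B.flip y), LinearMap.flip_apply]

end IsBalanced

/-- The functionals annihilated on the left by the functionals that vanish on `X`. -/
def annConv (X : Submodule k C) : Submodule k (C →ₗ[k] k) where
  carrier := {a | ∀ i : C →ₗ[k] k, (∀ x ∈ X, i x = 0) → conv i a = 0}
  add_mem' {a b} ha hb i hi := by
    have := congrArg ofConv (mul_add (toConv i) (toConv a) (toConv b))
    exact this.trans (by rw [ofConv_add]; exact (congrArg₂ _ (ha i hi) (hb i hi)).trans (add_zero 0))
  zero_mem' i _ := congrArg ofConv (mul_zero (toConv i))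
  smul_mem' r a ha i hi :=
    (congrArg ofConv (mul_smul_comm r (toConv i) (toConv a))).trans
      ((congrArg (r • ·) (ha i hi)).trans (smul_zero r))

/-- The elements of a coalgebra annihilated by the functionals that vanish on `X`. -/
def annAct (X : Submodule k C) : Submodule k C where
  carrier := {c | ∀ i : C →ₗ[k] k, (∀ x ∈ X, i x = 0) → actL i c = 0}
  add_mem' ha hb i hi := by rw [map_add, ha i hi, hb i hi, add_zero]
  zero_mem' i _ := map_zero _
  smul_mem' r a ha i hi := by rw [map_smul, ha i hi, smul_zero]

lemma annAct_le (X : Submodule k C) : annAct X ≤ X := by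
  intro c hc
  refine mem_of_forall_dual X c fun i hi ↦ ?_
  -- $i(c)=(\varepsilon*i)(c)=\varepsilon(i\cdot c)$.
  rw [← counit_conv i, ← apply_actL, hc i hi, map_zero]

/-- Every element of a coalgebra has finite left support. -/
lemma exists_support (z : C) : ∃ X : Submodule k C, FiniteDimensional k X ∧
    ∀ i : C →ₗ[k] k, (∀ x ∈ X, i x = 0) → actR i z = 0 := by
  let r := ℛ k z
  refine ⟨Submodule.span k (r.left '' r.index),
    FiniteDimensional.span_of_finite k (r.index.finite_toSet.image _), fun i hi ↦ ?_⟩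
  change (TensorProduct.lid k C) (i.rTensor C (comul z)) = 0
  rw [← r.eq, map_sum, map_sum]
  refine Finset.sum_eq_zero fun j hj ↦ ?_
  rw [LinearMap.rTensor_tmul, hi _ (Submodule.subset_span ⟨j, hj, rfl⟩), TensorProduct.zero_tmul,
    map_zero]

variable {B B' : C →ₗ[k] C →ₗ[k] k}

lemma map_annAct_le (hB : IsBalanced B) (X : Submodule k C) :
    (annAct X).map B ≤ annConv X := by
  rintro _ ⟨c, hc, rfl⟩ i hi
  rw [← hB.apply_left, hc i hi, map_zero]

/-- Local units supplied by the two forms show that such a functional is represented by an element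
of $C$, first through $B$ on the right and then through $B'$ on the left. -/
lemma annConv_le_map (hB : IsBalanced B) (hB' : IsBalanced B') (hinj : Function.Injective B)
    (hinj' : Function.Injective B'.flip) (X : Submodule k C) [FiniteDimensional k X] :
    annConv X ≤ (annAct X).map B' := by
  intro a ha
  -- $B(-,y)$ agrees with $\varepsilon$ on $X$, so it acts on `a` as a left unit:
  -- $a=B(-,y)*a=B(-,y\cdot a)$.
  obtain ⟨y, hy⟩ := exists_flip_eq_on hinj X counit
  have h1 : a = B.flip (actR a y) := by
    have := ha (B.flip y - counit) fun x hx ↦ by simp [hy x hx]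
    rwa [sub_conv, counit_conv, sub_eq_zero, ← hB.apply_right, eq_comm] at this
  -- With $z=y\cdot a$ supported on $Y$ and $B'(c,-)=\varepsilon$ on $Y$, one has $z\cdot
  -- B'(c,-)=z$. Applying $B(-,\cdot)$ gives $a*B'(c,-)=a$, that is, $a=B'(a\cdot c,-)$.
  obtain ⟨Y, hYfin, hY⟩ := exists_support (k := k) (actR a y)
  obtain ⟨c, hc⟩ := exists_flip_eq_on hinj' Y counit
  have h2 : a = B' (actL a c) := by
    have h := hY (B' c - counit (R := k)) fun x hx ↦ by
      have := hc x hx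
      rw [LinearMap.flip_apply] at this
      simp [this]
    have h := congrArg B.flip h
    rw [hB.apply_right, ← h1, map_zero, conv_sub, conv_counit, sub_eq_zero,
      ← hB'.apply_left] at h
    exact h.symm
  refine ⟨actL a c, fun i hi ↦ eq_of_forall_dual (k := k) fun b ↦ ?_, h2.symm⟩
  rw [map_zero, apply_actL, apply_actL, conv_assoc, ha i hi]
  exact congrArg (fun a : DualAlgebra k C ↦ a.ofConv c) (mul_zero (toConv b))

/-- A dimension count: $B$ embeds `annAct X` in `annConv X`, while `annConv X` lies in the image of
`annAct X` under $B'$, so both have the same finite dimension. -/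
lemma annConv_eq_map (hB : IsBalanced B) (hB' : IsBalanced B') (hinj : Function.Injective B)
    (hinj' : Function.Injective B'.flip) (X : Submodule k C) [FiniteDimensional k X] :
    (annAct X).map B = annConv X := by
  have : FiniteDimensional k (annAct X) := Submodule.finiteDimensional_of_le (annAct_le X)
  have hle := annConv_le_map hB hB' hinj hinj' X
  have : FiniteDimensional k (annConv X) := Submodule.finiteDimensional_of_le hle
  refine Submodule.eq_of_le_of_finrank_le (map_annAct_le hB X) ?_
  rw [← (Submodule.equivMapOfInjective B hinj (annAct X)).finrank_eq]
  exact (Submodule.finrank_mono hle).trans (Submodule.finrank_map_le B' _)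

end Forms

/-! ### Maps represented by tensors -/

section Pairing

variable {k C M : Type*} [Field k] [AddCommGroup C] [Module k C] [AddCommGroup M] [Module k M]

/-- The map `C ⊗ M → Hom(C, M)` sending `x ⊗ m` to `c ↦ B(x, c) m`. -/
noncomputable def pair (M : Type*) [AddCommGroup M] [Module k M] (B : C →ₗ[k] C →ₗ[k] k) :
    C ⊗[k] M →ₗ[k] C →ₗ[k] M :=
  dualTensorHom k C M ∘ₗ LinearMap.rTensor M B

@[simp]
lemma pair_tmul (B : C →ₗ[k] C →ₗ[k] k) (x c : C) (m : M) :
    pair M B (x ⊗ₜ m) c = B x c • m := rfl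

lemma pair_injective {B : C →ₗ[k] C →ₗ[k] k} (hB : Function.Injective B) :
    Function.Injective (pair M B) := by
  rw [injective_iff_map_eq_zero]
  intro t ht
  classical
  let b := Module.Basis.ofVectorSpace k M
  -- In a basis of `M` the claim reduces, coordinate by coordinate, to injectivity of `B`.
  have key (t : C ⊗[k] M) (c : C) (j) :
      B (TensorProduct.equivFinsuppOfBasisRight b t j) c = b.repr (pair M B t c) j := by
    induction t with
    | zero => simp
    | add x y hx hy => simp [hx, hy]
    | tmul x m => simp [mul_comm]
  refine (TensorProduct.equivFinsuppOfBasisRight b).map_eq_zero_iff.mp ?_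
  ext j
  refine hB ?_
  ext c
  rw [key, ht]
  simp

/-- A linear map whose composites with all functionals lie in the image of a finite dimensional
space under `B` comes from a tensor. -/
lemma exists_pair_eq (B : C →ₗ[k] C →ₗ[k] k) (X : Submodule k C) [FiniteDimensional k X]
    (h : C →ₗ[k] M) (hh : ∀ φ : M →ₗ[k] k, φ ∘ₗ h ∈ X.map B) : ∃ t, pair M B t = h := by
  -- `K` is the right orthogonal of `X`, of finite codimension. Since `h` vanishes on it, `h` has
  -- finite rank.
  let K : Submodule k C := LinearMap.ker (B ∘ₗ X.subtype).flip
  have hK : K ≤ LinearMap.ker h := by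
    intro c hc
    refine eq_of_forall_dual (k := k) fun φ ↦ ?_
    obtain ⟨x, hx, hxφ⟩ := hh φ
    have h1 := LinearMap.congr_fun hxφ c
    have h2 := LinearMap.congr_fun (show (B ∘ₗ X.subtype).flip c = 0 from hc) ⟨x, hx⟩
    rw [map_zero]
    exact h1.symm.trans h2
  have : FiniteDimensional k (LinearMap.range h) := by
    have : FiniteDimensional k (C ⧸ K) :=
      Module.Finite.equiv (LinearMap.quotKerEquivRange (B ∘ₗ X.subtype).flip).symm
    have hr : LinearMap.range h = LinearMap.range (K.liftQ h hK) := (Submodule.range_liftQ _ _ _).symm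
    rw [hr]
    infer_instance
  let b := Module.finBasis k (LinearMap.range h)
  have hφ (j) : ∃ φ : M →ₗ[k] k, φ ∘ₗ (LinearMap.range h).subtype = b.coord j :=
    LinearMap.exists_extend (b.coord j)
  choose φ hφ using hφ
  choose x _ hx using fun j ↦ hh (φ j)
  refine ⟨∑ j, x j ⊗ₜ (b j : M), ?_⟩
  ext c
  have := congrArg Subtype.val (b.sum_repr ⟨h c, c, rfl⟩)
  rw [Submodule.coe_sum] at this
  rw [map_sum, LinearMap.sum_apply]
  refine Eq.trans ?_ this
  refine Finset.sum_congr rfl fun j _ ↦ ?_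
  rw [pair_tmul, hx]
  exact congrArg (· • (b j : M)) (LinearMap.congr_fun (hφ j) ⟨h c, c, rfl⟩)

lemma pair_lTensor (B : C →ₗ[k] C →ₗ[k] k) {N : Type*} [AddCommGroup N] [Module k N]
    (ρ : M →ₗ[k] N) (t : C ⊗[k] M) : pair N B (ρ.lTensor C t) = ρ ∘ₗ pair M B t := by
  induction t with
  | zero => simp
  | add x y hx hy => simp [hx, hy, LinearMap.comp_add]
  | tmul x m => ext; simp

end Pairing

/-! ### Integrals of left comodules -/

section LeftComodule

open Coalgebra

variable {k C M : Type*} [Field k] [AddCommGroup C] [Module k C] [Coalgebra k C]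
  [AddCommGroup M] [Module k M] {B B' : C →ₗ[k] C →ₗ[k] k}

/-- This translates colinearity of the map into coassociativity of the tensor; on pure tensors it is
`actR_flip`. -/
lemma IsBalanced.pair_comul (hB : IsBalanced B) (t : C ⊗[k] M) :
    pair (C ⊗[k] M) B (TensorProduct.assoc k C C M (comul.rTensor M t)) =
      (pair M B t).lTensor C ∘ₗ comul := by
  induction t with
  | zero => simp
  | add x y hx hy => simp only [map_add, hx, hy, LinearMap.lTensor_add, LinearMap.add_comp]
  | tmul x m =>
    ext c
    have h1 (s : C ⊗[k] C) : pair (C ⊗[k] M) B (TensorProduct.assoc k C C M (s ⊗ₜ m)) c =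
        TensorProduct.lid k C ((B.flip c).rTensor C s) ⊗ₜ m := by
      induction s with
      | zero => simp
      | add x y hx hy => simp only [map_add, hx, hy, TensorProduct.add_tmul, LinearMap.add_apply]
      | tmul x y => simp [TensorProduct.smul_tmul']
    have h2 (s : C ⊗[k] C) : (pair M B (x ⊗ₜ m)).lTensor C s =
        TensorProduct.rid k C ((B x).lTensor C s) ⊗ₜ m := by
      induction s with
      | zero => simp
      | add x y hx hy => simp only [map_add, hx, hy, TensorProduct.add_tmul]
      | tmul y z => simp [TensorProduct.smul_tmul]
    rw [LinearMap.rTensor_tmul, h1, LinearMap.comp_apply, h2]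
    exact congrArg (· ⊗ₜ m) (hB.actR_flip x c)

variable [LeftComodule k C M]

lemma coact_counital (m : M) :
    TensorProduct.lid k M (counit.rTensor M (LeftComodule.coact (C := C) m)) = m :=
  LinearMap.congr_fun (LeftComodule.counital (k := k) (C := C) (M := M)) m

lemma coact_coassoc (m : M) :
    TensorProduct.assoc k C C M (comul.rTensor M (LeftComodule.coact m)) =
      LinearMap.lTensor C LeftComodule.coact (LeftComodule.coact (C := C) m) :=
  LinearMap.congr_fun (LeftComodule.coassoc (k := k) (C := C) (M := M)) m

lemma mem_leftIntegrals {h : C →ₗ[k] M} : h ∈ LeftIntegrals k C M ↔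
    LeftComodule.coact (C := C) ∘ₗ h = h.lTensor C ∘ₗ comul := Iff.rfl

/-- Apply $\varepsilon$ to the first tensor factor of both sides of `ht`. -/
lemma eq_coact_of_coassoc (t : C ⊗[k] M)
    (ht : TensorProduct.assoc k C C M (comul.rTensor M t) =
      LinearMap.lTensor C LeftComodule.coact t) :
    LeftComodule.coact (TensorProduct.lid k M (counit.rTensor M t)) = t := by
  have h1 (t : C ⊗[k] M) : TensorProduct.lid k (C ⊗[k] M)
      (counit.rTensor (C ⊗[k] M) (TensorProduct.assoc k C C M (comul.rTensor M t))) = t := by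
    have h0 (s : C ⊗[k] C) (m : M) : TensorProduct.lid k (C ⊗[k] M)
        (counit.rTensor (C ⊗[k] M) (TensorProduct.assoc k C C M (s ⊗ₜ m))) =
          TensorProduct.lid k C (counit.rTensor C s) ⊗ₜ m := by
      induction s with
      | zero => simp
      | add x y hx hy => simp only [map_add, hx, hy, TensorProduct.add_tmul]
      | tmul x y => simp [TensorProduct.smul_tmul']
    induction t with
    | zero => simp
    | add x y hx hy => simp only [map_add, hx, hy]
    | tmul x m => rw [LinearMap.rTensor_tmul, h0]; simp
  have h2 (t : C ⊗[k] M) : TensorProduct.lid k (C ⊗[k] M)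
      (counit.rTensor (C ⊗[k] M) (LinearMap.lTensor C LeftComodule.coact t)) =
        LeftComodule.coact (TensorProduct.lid k M (counit.rTensor M t)) := by
    induction t with
    | zero => simp
    | add x y hx hy => simp only [map_add, hx, hy]
    | tmul x m => simp
  rw [← h2, ← ht, h1]

/-- The integral attached to an element of a left comodule. -/
noncomputable def leftIntegral (M : Type*) [AddCommGroup M] [Module k M] [LeftComodule k C M]
    (hB : IsBalanced B) : M →ₗ[k] LeftIntegrals k C M :=
  (pair M B ∘ₗ LeftComodule.coact).codRestrict _ fun m ↦ by
    rw [mem_leftIntegrals, LinearMap.comp_apply, ← pair_lTensor, ← hB.pair_comul, coact_coassoc]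

lemma leftIntegral_injective (hB : IsBalanced B) (hinj : Function.Injective B) :
    Function.Injective (leftIntegral M hB) := by
  intro m n h
  have := pair_injective hinj (congrArg Subtype.val h)
  rw [← coact_counital (k := k) (C := C) m, this, coact_counital]

/-- Colinearity gives $(i*(\varphi\circ h))(c)=(i\otimes\varphi)(\rho(h(c)))$, and $\rho(h(c))\in
X\otimes M$ is killed by $i$. -/
lemma comp_mem_annConv {X : Submodule k C}
    (hX : LinearMap.range (LeftComodule.coact (k := k) (C := C) (M := M)) ≤
      LinearMap.range (X.subtype.rTensor M))
    {h : C →ₗ[k] M} (hh : h ∈ LeftIntegrals k C M) (φ : M →ₗ[k] k) : φ ∘ₗ h ∈ annConv X := by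
  intro i hi
  ext c
  have h1 : conv i (φ ∘ₗ h) c =
      (LinearMap.mul' k k ∘ₗ TensorProduct.map i φ) (h.lTensor C (comul c)) := by
    change (LinearMap.mul' k k ∘ₗ TensorProduct.map i (φ ∘ₗ h)) (comul c) =
      ((LinearMap.mul' k k ∘ₗ TensorProduct.map i φ) ∘ₗ h.lTensor C) (comul c)
    congr 1
    ext x y
    simp
  obtain ⟨s, hs⟩ := hX ⟨h c, rfl⟩
  have h2 : LeftComodule.coact (h c) = h.lTensor C (comul c) :=
    LinearMap.congr_fun (mem_leftIntegrals.mp hh) c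
  rw [h1, ← h2, ← hs, ← LinearMap.comp_apply]
  have h3 : (LinearMap.mul' k k ∘ₗ TensorProduct.map i φ) ∘ₗ X.subtype.rTensor M = 0 := by
    ext x m
    simp [hi x x.2]
  rw [h3]
  rfl

lemma leftIntegral_surjective (hB : IsBalanced B) (hB' : IsBalanced B')
    (hinj : Function.Injective B) (hinj' : Function.Injective B'.flip)
    (hM : LeftComodule.HasFiniteSupport k C M) :
    Function.Surjective (leftIntegral M hB) := by
  rintro ⟨h, hh⟩
  obtain ⟨X, hXfin, hX⟩ := hM
  have : FiniteDimensional k (annAct X) := Submodule.finiteDimensional_of_le (annAct_le X)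
  obtain ⟨t, rfl⟩ := exists_pair_eq B (annAct X) h fun φ ↦ by
    rw [annConv_eq_map hB hB' hinj hinj' X]
    exact comp_mem_annConv hX hh φ
  -- Both sides of the colinearity equation are now values of `pair`, so injectivity yields
  -- coassociativity of `t`.
  rw [mem_leftIntegrals, ← pair_lTensor, ← hB.pair_comul] at hh
  have ht := eq_coact_of_coassoc t (pair_injective hinj hh).symm
  exact ⟨_, Subtype.ext (congrArg (pair M B) ht)⟩

end LeftComodule

theorem rank_leftIntegrals {k : Type u} [Field k] {C : Type v} [AddCommGroup C] [Module k C]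
    [Coalgebra k C] (hl : IsLeftCoFrobenius k C) (hr : IsRightCoFrobenius k C)
    (M : Type w) [AddCommGroup M] [Module k M] [LeftComodule k C M]
    (hM : LeftComodule.HasFiniteSupport k C M) :
    Module.rank k (LeftIntegrals k C M) = Cardinal.lift.{v} (Module.rank k M) := by
  obtain ⟨f, hf, hfl⟩ := hl
  obtain ⟨g, hg, hgr⟩ := hr
  let e := (WithConv.linearEquiv k (C →ₗ[k] k)).toLinearMap
  let B : C →ₗ[k] C →ₗ[k] k := e ∘ₗ f
  -- The flip turns right linearity of `g` into the same balance condition that left linearity of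
  -- `f` gives for `B`.
  let B' : C →ₗ[k] C →ₗ[k] k := (e ∘ₗ g).flip
  have hB : IsBalanced B := fun a x y ↦ by
    rw [apply_actR]
    exact congrArg (fun b : DualAlgebra k C ↦ b.ofConv y) (hfl (WithConv.toConv a) x)
  have hB' : IsBalanced B' := fun a x y ↦ by
    change g y (actL a x) = g (actR a y) x
    refine (apply_actL _ _ _).trans ?_
    exact congrArg (fun b : DualAlgebra k C ↦ b.ofConv x) (hgr y (WithConv.toConv a)).symm
  have hinj : Function.Injective B := (WithConv.linearEquiv k _).injective.comp hf
  have hinj' : Function.Injective B'.flip := (WithConv.linearEquiv k _).injective.comp hg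
  have h := (LinearEquiv.ofBijective (leftIntegral M hB) ⟨leftIntegral_injective hB hinj,
    leftIntegral_surjective hB hB' hinj hinj' hM⟩).lift_rank_eq
  rw [Cardinal.lift_umax.{w, v}, Cardinal.lift_id'.{w, v}] at h
  exact h.symm

/-! ### Passage to the co-opposite coalgebra -/

section Coopposite

variable {k C N : Type*} [Field k] [AddCommGroup C] [Module k C] [AddCommGroup N] [Module k N]

/-- The reversal `x ⊗ (y ⊗ z) ↦ z ⊗ (y ⊗ x)`. -/
noncomputable def reverse (k C N : Type*) [Field k] [AddCommGroup C] [Module k C]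
    [AddCommGroup N] [Module k N] : N ⊗[k] (C ⊗[k] C) →ₗ[k] C ⊗[k] (C ⊗[k] N) :=
  (TensorProduct.assoc k C C N).toLinearMap ∘ₗ
    (TensorProduct.comm k C C).toLinearMap.rTensor N ∘ₗ
      (TensorProduct.comm k N (C ⊗[k] C)).toLinearMap

lemma assoc_rTensor_comm (δ : C →ₗ[k] C ⊗[k] C) :
    (TensorProduct.assoc k C C N).toLinearMap ∘ₗ
      ((TensorProduct.comm k C C).toLinearMap ∘ₗ δ).rTensor N ∘ₗ
        (TensorProduct.comm k N C).toLinearMap = reverse k C N ∘ₗ δ.lTensor N := by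
  ext x y
  simp [reverse]

lemma lTensor_comm (ρ : N →ₗ[k] N ⊗[k] C) :
    ((TensorProduct.comm k N C).toLinearMap ∘ₗ ρ).lTensor C ∘ₗ
        (TensorProduct.comm k N C).toLinearMap =
      reverse k C N ∘ₗ (TensorProduct.assoc k N C C).toLinearMap ∘ₗ ρ.rTensor C := by
  have h (y : C) (s : N ⊗[k] C) : y ⊗ₜ TensorProduct.comm k N C s =
      reverse k C N (TensorProduct.assoc k N C C (s ⊗ₜ y)) := by
    induction s with
    | zero => simp
    | add a b ha hb => simp only [map_add, ha, hb, TensorProduct.add_tmul, TensorProduct.tmul_add]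
    | tmul a b => simp [reverse]
  ext x y
  simpa using h y (ρ x)

lemma lid_rTensor_comm {V : Type*} [AddCommGroup V] [Module k V] (a : C →ₗ[k] k) (s : V ⊗[k] C) :
    TensorProduct.lid k V (a.rTensor V (TensorProduct.comm k V C s)) =
      TensorProduct.rid k V (a.lTensor V s) := by
  induction s with
  | zero => simp
  | add x y hx hy => simp only [map_add, hx, hy]
  | tmul x y => simp

lemma rid_lTensor_comm {V : Type*} [AddCommGroup V] [Module k V] (a : C →ₗ[k] k) (s : C ⊗[k] V) :
    TensorProduct.rid k V (a.lTensor V (TensorProduct.comm k C V s)) =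
      TensorProduct.lid k V (a.rTensor V s) := by
  induction s with
  | zero => simp
  | add x y hx hy => simp only [map_add, hx, hy]
  | tmul x y => simp

lemma mul_map_comm (a b : C →ₗ[k] k) (s : C ⊗[k] C) :
    LinearMap.mul' k k (TensorProduct.map a b (TensorProduct.comm k C C s)) =
      LinearMap.mul' k k (TensorProduct.map b a s) := by
  induction s with
  | zero => simp
  | add x y hx hy => simp only [map_add, hx, hy]
  | tmul x y => simp [mul_comm]

/-- A type synonym carrying the co-opposite coalgebra structure. -/
def Coopposite (C : Type*) := C

instance : AddCommGroup (Coopposite C) := inferInstanceAs (AddCommGroup C)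

instance : Module k (Coopposite C) := inferInstanceAs (Module k C)

variable [Coalgebra k C]

noncomputable instance : Coalgebra k (Coopposite C) where
  comul := ((TensorProduct.comm k C C).toLinearMap ∘ₗ Coalgebra.comul : C →ₗ[k] C ⊗[k] C)
  counit := (Coalgebra.counit : C →ₗ[k] k)
  coassoc := by
    change (TensorProduct.assoc k C C C).toLinearMap ∘ₗ
      ((TensorProduct.comm k C C).toLinearMap ∘ₗ Coalgebra.comul).rTensor C ∘ₗ
        (TensorProduct.comm k C C).toLinearMap ∘ₗ Coalgebra.comul =
      ((TensorProduct.comm k C C).toLinearMap ∘ₗ Coalgebra.comul).lTensor C ∘ₗ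
        (TensorProduct.comm k C C).toLinearMap ∘ₗ Coalgebra.comul
    have h1 := congrArg (· ∘ₗ Coalgebra.comul (R := k) (A := C))
      (assoc_rTensor_comm (N := C) (Coalgebra.comul (R := k) (A := C)))
    have h2 := congrArg (· ∘ₗ Coalgebra.comul (R := k) (A := C))
      (lTensor_comm (Coalgebra.comul (R := k) (A := C)))
    simp only [LinearMap.comp_assoc] at h1 h2
    rw [h1, h2, Coalgebra.coassoc]
  rTensor_counit_comp_comul := by
    refine LinearMap.ext fun c : C ↦ (TensorProduct.lid k C).injective ?_
    refine (lid_rTensor_comm (V := C) Coalgebra.counit (Coalgebra.comul c)).trans ?_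
    rw [Coalgebra.lTensor_counit_comul]
    exact (TensorProduct.rid_tmul _ _).trans (TensorProduct.lid_tmul _ _).symm
  lTensor_counit_comp_comul := by
    refine LinearMap.ext fun c : C ↦ (TensorProduct.rid k C).injective ?_
    refine (rid_lTensor_comm (V := C) Coalgebra.counit (Coalgebra.comul c)).trans ?_
    rw [Coalgebra.rTensor_counit_comul]
    exact (TensorProduct.lid_tmul _ _).trans (TensorProduct.rid_tmul _ _).symm

/-- A right comodule is a left comodule over the co-opposite coalgebra. -/
@[reducible] noncomputable def leftComoduleCoopposite [RightComodule k C N] :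
    LeftComodule k (Coopposite C) N where
  coact := ((TensorProduct.comm k N C).toLinearMap ∘ₗ RightComodule.coact : N →ₗ[k] C ⊗[k] N)
  coassoc := by
    change (TensorProduct.assoc k C C N).toLinearMap ∘ₗ
      ((TensorProduct.comm k C C).toLinearMap ∘ₗ Coalgebra.comul).rTensor N ∘ₗ
        (TensorProduct.comm k N C).toLinearMap ∘ₗ RightComodule.coact =
      ((TensorProduct.comm k N C).toLinearMap ∘ₗ RightComodule.coact).lTensor C ∘ₗ
        (TensorProduct.comm k N C).toLinearMap ∘ₗ RightComodule.coact
    have h1 := congrArg (· ∘ₗ RightComodule.coact (k := k) (C := C) (N := N))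
      (assoc_rTensor_comm (N := N) (Coalgebra.comul (R := k) (A := C)))
    have h2 := congrArg (· ∘ₗ RightComodule.coact (k := k) (C := C) (N := N))
      (lTensor_comm (RightComodule.coact (k := k) (C := C) (N := N)))
    simp only [LinearMap.comp_assoc] at h1 h2
    rw [h1, h2, RightComodule.coassoc]
  counital := LinearMap.ext fun n ↦
    (lid_rTensor_comm (V := N) (Coalgebra.counit (R := k) (A := C)) (RightComodule.coact n)).trans
      (LinearMap.congr_fun (RightComodule.counital (k := k) (C := C) (N := N)) n)

/-- The same map works: reversing comultiplication swaps the two actions and reverses the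
convolution product. -/
lemma isLeftCoFrobenius_coopposite (h : IsRightCoFrobenius k C) :
    IsLeftCoFrobenius k (Coopposite C) := by
  obtain ⟨f, hf, hfa⟩ := h
  refine ⟨(f : C →ₗ[k] WithConv (C →ₗ[k] k)), hf, fun a (c : C) ↦ ?_⟩
  refine (congrArg f (rid_lTensor_comm (C := C) (V := C) a.ofConv (Coalgebra.comul (R := k) (A := C) c))).trans
    ((hfa c a).trans ?_)
  refine WithConv.ext (LinearMap.ext fun x : C ↦ ?_)
  exact (mul_map_comm (C := C) a.ofConv (f c).ofConv (Coalgebra.comul (R := k) (A := C) x)).symm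

lemma isRightCoFrobenius_coopposite (h : IsLeftCoFrobenius k C) :
    IsRightCoFrobenius k (Coopposite C) := by
  obtain ⟨f, hf, hfa⟩ := h
  refine ⟨(f : C →ₗ[k] WithConv (C →ₗ[k] k)), hf, fun (c : C) a ↦ ?_⟩
  refine (congrArg f (lid_rTensor_comm (C := C) (V := C) a.ofConv (Coalgebra.comul (R := k) (A := C) c))).trans
    ((hfa a c).trans ?_)
  refine WithConv.ext (LinearMap.ext fun x : C ↦ ?_)
  exact (mul_map_comm (C := C) (f c).ofConv a.ofConv (Coalgebra.comul (R := k) (A := C) x)).symm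

lemma hasFiniteSupport_coopposite [RightComodule k C N]
    (h : RightComodule.HasFiniteSupport k C N) :
    letI := leftComoduleCoopposite (k := k) (C := C) (N := N)
    LeftComodule.HasFiniteSupport k (Coopposite C) N := by
  obtain ⟨X, hXfin, hX⟩ := h
  refine ⟨(X : Submodule k C), hXfin, ?_⟩
  rintro _ ⟨n, rfl⟩
  obtain ⟨s, hs⟩ := hX ⟨n, rfl⟩
  refine ⟨TensorProduct.comm k N X s, ?_⟩
  change X.subtype.rTensor N (TensorProduct.comm k N X s) =
    TensorProduct.comm k N C (RightComodule.coact n)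
  rw [← hs]
  exact LinearMap.congr_fun (LinearMap.rTensor_comp_comm X.subtype) s

lemma leftIntegrals_coopposite [RightComodule k C N] :
    letI := leftComoduleCoopposite (k := k) (C := C) (N := N)
    (LeftIntegrals k (Coopposite C) N : Submodule k (C →ₗ[k] N)) = RightIntegrals k C N := by
  refine Submodule.ext fun f : C →ₗ[k] N ↦ ?_
  have h : f.lTensor C ∘ₗ (TensorProduct.comm k C C).toLinearMap =
      (TensorProduct.comm k N C).toLinearMap ∘ₗ f.rTensor C := by
    ext x y
    simp
  have h' : (TensorProduct.comm k N C).toLinearMap ∘ₗ RightComodule.coact ∘ₗ f =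
      f.lTensor C ∘ₗ (TensorProduct.comm k C C).toLinearMap ∘ₗ Coalgebra.comul ↔
      RightComodule.coact (C := C) ∘ₗ f = f.rTensor C ∘ₗ Coalgebra.comul := by
    rw [← LinearMap.comp_assoc (f := Coalgebra.comul), h, LinearMap.comp_assoc]
    exact (LinearMap.cancel_left (TensorProduct.comm k N C).injective)
  exact h'

end Coopposite

theorem rank_rightIntegrals {k : Type u} [Field k] {C : Type v} [AddCommGroup C] [Module k C]
    [Coalgebra k C] (hl : IsLeftCoFrobenius k C) (hr : IsRightCoFrobenius k C)
    (M : Type w) [AddCommGroup M] [Module k M] [RightComodule k C M]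
    (hM : RightComodule.HasFiniteSupport k C M) :
    Module.rank k (RightIntegrals k C M) = Cardinal.lift.{v} (Module.rank k M) := by
  rw [← leftIntegrals_coopposite]
  let _ := leftComoduleCoopposite (k := k) (C := C) (N := M)
  exact rank_leftIntegrals (isLeftCoFrobenius_coopposite hr) (isRightCoFrobenius_coopposite hl) M
    (hasFiniteSupport_coopposite hM)

end CoFrobenius

theorem mainTheorem2 {k : Type u} [Field k] {C : Type v} [AddCommGroup C] [Module k C]
    [Coalgebra k C] (hl : IsLeftCoFrobenius k C) (hr : IsRightCoFrobenius k C) :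
    (∀ (M : Type w) [AddCommGroup M] [Module k M] [LeftComodule k C M],
      LeftComodule.HasFiniteSupport k C M →
        Module.rank k (LeftIntegrals k C M) = Cardinal.lift.{v} (Module.rank k M)) ∧
    (∀ (M : Type w) [AddCommGroup M] [Module k M] [RightComodule k C M],
      RightComodule.HasFiniteSupport k C M →
        Module.rank k (RightIntegrals k C M) = Cardinal.lift.{v} (Module.rank k M)) :=
  ⟨fun M _ _ _ hM ↦ CoFrobenius.rank_leftIntegrals hl hr M hM,
    fun M _ _ _ hM ↦ CoFrobenius.rank_rightIntegrals hl hr M hM⟩
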